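/- **Theorem 2.** There is a $C^*$-algebra $\mathcal A$ with a hereditary $C^*$-subalgebra $\mathcal B\subset\mathcal A$ (a norm-closed $*$-subalgebra such that $0\le a\le b\in\mathcal B$, $a\in\mathcal A$, implies $a\in\mathcal B$) that separates the points of $\mathcal A$ (that is, $a\mathcal B=\{0\}$ implies $a=0$ for $a\in\mathcal A$), such that there is no faithful representation $\pi$ of $\mathcal A$ on a Hilbert space $H$ for which $\pi(\mathcal B)$ acts nondegenerately, i.e. for which $\overline{\mathrm{span}}\,\pi(\mathcal B)H=H$. More precisely, let $C=C[0,1]$, let $(q_n)_{n\ge1}$ be any sequence in $(0,1]$ that is dense in $[0,1]$, and let $\psi_{n,m}\in C$ ($n,m\ge1$) be any functions with $\sum_{m}|\psi_{n,m}(t)|^2=\chi_{[0,q_n)}(t)$ for all $n$ and all $t\in[0,1]$. Let $S=\{0\}\cup(\mathbb N\times\mathbb N)$ and let $$E=C^{S}=\Bigl\{(b_s)_{s\in S}: b_s\in C,\ \sum_{s\in S} b_s^*b_s \text{ converges in norm over the finite subsets of } S\Bigr\}$$ be the standard Hilbert $C$-module with inner product $\langle b,b'\rangle=\sum_s b_s^*b'_s$.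 Let $F\subset E$ be the closed $C$-submodule generated by the elements $\zeta_{k,\ell}$ ($k,\ell\ge1$) whose entry at $0$ is $2^{-k}\psi_{k,\ell}^*$, whose entry at $(k,\ell)$ is $-1$, and whose other entries are $0$. Let $\mathcal K(E)$ be the $C^*$-algebra of compact operators on $E$, i.e. the closed linear span of the operators $xy^*\colon z\mapsto x\langle y,z\rangle$ with $x,y\in E$, and let $\mathcal K(F)\subset\mathcal K(E)$ be the closed linear span of those with $x,y\in F$. Then $\mathcal A=\mathcal K(E)$ and $\mathcal B=\mathcal K(F)$ have all the properties above. -/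

import Mathlib

open scoped ComplexOrder InnerProductSpace

set_option linter.unusedSectionVars false

noncomputable section

/-! ### Hereditary subalgebras and nondegenerate representations -/

/-- `B` is a hereditary C⋆-subalgebra of `A`: it is norm closed, and `0 ≤ a ≤ b` with `b ∈ B`
forces `a ∈ B`. The order is the usual one of a C⋆-algebra. -/
def IsHereditaryCStarSubalgebra {A : Type*} [NonUnitalCStarAlgebra A]
    (B : NonUnitalStarSubalgebra ℂ A) : Prop :=
  IsClosed (B : Set A) ∧
    letI := CStarAlgebra.spectralOrder A
    ∀ a b : A, 0 ≤ a → a ≤ b → b ∈ B → a ∈ B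

/-- `B` separates the points of `A`: `a B = {0}` implies `a = 0`. -/
def SeparatesPointsOf {A : Type*} [NonUnitalCStarAlgebra A]
    (B : NonUnitalStarSubalgebra ℂ A) : Prop :=
  ∀ a : A, (∀ b ∈ B, a * b = 0) → a = 0

/-- `π(B)` acts nondegenerately on `H`: the vectors `π(b) h` span a dense subspace. -/
def ActsNondegenerately {A : Type*} [NonUnitalCStarAlgebra A]
    {H : Type*} [NormedAddCommGroup H] [InnerProductSpace ℂ H] [CompleteSpace H]
    (π : A →⋆ₙₐ[ℂ] (H →L[ℂ] H)) (B : NonUnitalStarSubalgebra ℂ A) : Prop :=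
  (Submodule.span ℂ {v : H | ∃ b ∈ B, ∃ h : H, π b h = v}).topologicalClosure = ⊤

/-! ### Adjointable and compact operators on a Hilbert module -/

namespace HilbertModule

section Operators

variable (A E : Type*) [CStarAlgebra A] [PartialOrder A] [StarOrderedRing A]
  [NormedAddCommGroup E] [NormedSpace ℂ E] [Module A E] [CStarModule A E]

/-- The bounded operators on the Hilbert `A`-module `E` that have an adjoint. -/
def adjointableSubalgebra : Subalgebra ℂ (E →L[ℂ] E) where
  carrier := {T | ∃ T' : E →L[ℂ] E, ∀ x y : E, ⟪T x, y⟫_A = ⟪x, T' y⟫_A}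
  mul_mem' := by
    rintro T U ⟨T', hT⟩ ⟨U', hU⟩
    exact ⟨U' * T', fun x y => by simp [hT, hU]⟩
  add_mem' := by
    rintro T U ⟨T', hT⟩ ⟨U', hU⟩
    exact ⟨T' + U', fun x y => by simp [hT, hU]⟩
  algebraMap_mem' c := ⟨algebraMap ℂ _ (star c), fun x y => by
    simp [Algebra.algebraMap_eq_smul_one]⟩

/-- The algebra of adjointable operators on the Hilbert `A`-module `E`, with the operator norm. -/
def Adjointable : Type _ := adjointableSubalgebra A E

instance : NormedRing (Adjointable A E) := inferInstanceAs (NormedRing (adjointableSubalgebra A E))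

instance : NormedAlgebra ℂ (Adjointable A E) :=
  inferInstanceAs (NormedAlgebra ℂ (adjointableSubalgebra A E))

variable {A E}

/-- The underlying bounded operator of an adjointable operator. -/
def toCLM : Adjointable A E →ₐ[ℂ] (E →L[ℂ] E) := (adjointableSubalgebra A E).val

instance : CoeFun (Adjointable A E) (fun _ => E → E) := ⟨fun T => toCLM T⟩

namespace Adjointable

theorem mul_apply (T U : Adjointable A E) (x : E) : (T * U) x = T (U x) := by
  simp

theorem norm_toCLM (T : Adjointable A E) : ‖toCLM T‖ = ‖T‖ := rfl

theorem ext {T U : Adjointable A E} (h : ∀ x, T x = U x) : T = U :=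
  Subtype.ext (ContinuousLinearMap.ext h)

theorem eq_of_inner {x y : E} (h : ∀ z : E, ⟪z, x⟫_A = ⟪z, y⟫_A) : x = y := by
  rw [← sub_eq_zero, ← CStarModule.inner_self (A := A), CStarModule.inner_sub_right, h, sub_self]

/-- The adjoint. -/
instance : Star (Adjointable A E) where
  star T := ⟨T.2.choose, T.1, fun x y => by
    rw [← CStarModule.star_inner, ← T.2.choose_spec, CStarModule.star_inner]⟩

theorem inner_left (T : Adjointable A E) (x y : E) :
    ⟪T x, y⟫_A = ⟪x, (star T) y⟫_A := T.2.choose_spec x y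

theorem inner_right (T : Adjointable A E) (x y : E) :
    ⟪x, T y⟫_A = ⟪(star T) x, y⟫_A := by
  rw [← CStarModule.star_inner, inner_left, CStarModule.star_inner]

theorem star_eq {T U : Adjointable A E} (h : ∀ x y : E, ⟪T x, y⟫_A = ⟪x, U y⟫_A) :
    star T = U :=
  ext fun y => eq_of_inner (A := A) fun x => by rw [← inner_left, h]

instance : StarRing (Adjointable A E) where
  star_involutive T := star_eq fun x y => (inner_right T x y).symm
  star_mul T U := star_eq fun x y => by simp [inner_left]
  star_add T U := star_eq fun x y => by simp [inner_left]

instance : StarModule ℂ (Adjointable A E) where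
  star_smul c T := star_eq fun x y => by simp [inner_left]

instance : CStarRing (Adjointable A E) where
  norm_mul_self_le T := by
    have h : ‖toCLM T‖ ≤ √‖star T * T‖ := by
      refine (toCLM T).opNorm_le_bound (Real.sqrt_nonneg _) fun x => ?_
      have h1 : ‖T x‖ ^ 2 ≤ ‖star T * T‖ * ‖x‖ ^ 2 := by
        rw [CStarModule.norm_sq_eq A, inner_left]
        calc ‖⟪x, (star T) (T x)⟫_A‖ ≤ ‖x‖ * ‖(star T) (T x)‖ :=
              CStarModule.norm_inner_le E
          _ ≤ ‖x‖ * (‖star T * T‖ * ‖x‖) := by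
              gcongr
              rw [← mul_apply]
              exact (toCLM (star T * T)).le_opNorm x
          _ = _ := by ring
      calc ‖T x‖ ≤ √(‖star T * T‖ * ‖x‖ ^ 2) := Real.le_sqrt_of_sq_le h1
        _ = _ := by rw [Real.sqrt_mul (norm_nonneg _), Real.sqrt_sq (norm_nonneg _)]
    calc ‖T‖ * ‖T‖ ≤ √‖star T * T‖ * √‖star T * T‖ := by
          gcongr <;> exact h
      _ = _ := Real.mul_self_sqrt (norm_nonneg _)

theorem isClosed_adjointableSubalgebra [CompleteSpace E] :
    IsClosed (adjointableSubalgebra A E : Set (E →L[ℂ] E)) := by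
  refine isClosed_of_closure_subset fun T hT => ?_
  obtain ⟨t, ht, htT⟩ := mem_closure_iff_seq_limit.1 hT
  let u : ℕ → Adjointable A E := fun n => ⟨t n, ht n⟩
  have hc : CauchySeq fun n => toCLM (star (u n)) := by
    have h1 : CauchySeq t := htT.cauchySeq
    rw [Metric.cauchySeq_iff] at h1 ⊢
    intro ε hε
    obtain ⟨N, hN⟩ := h1 ε hε
    refine ⟨N, fun m hm n hn => ?_⟩
    have h2 : ‖toCLM (star (u m)) - toCLM (star (u n))‖ = ‖t m - t n‖ := by
      rw [← map_sub, norm_toCLM, ← star_sub, norm_star]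
      rfl
    rw [dist_eq_norm, h2, ← dist_eq_norm]
    exact hN m hm n hn
  obtain ⟨T', hT'⟩ := cauchySeq_tendsto_of_complete hc
  refine ⟨T', fun x y => ?_⟩
  have e1 : Filter.Tendsto (fun n => ⟪t n x, y⟫_A) Filter.atTop (nhds ⟪T x, y⟫_A) :=
    (CStarModule.continuous_inner (A := A) (E := E)).tendsto (T x, y) |>.comp
      ((((ContinuousLinearMap.apply ℂ E x).continuous.tendsto T).comp htT).prodMk_nhds
        tendsto_const_nhds)
  have e2 : Filter.Tendsto (fun n => ⟪x, (star (u n)) y⟫_A) Filter.atTop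
      (nhds ⟪x, T' y⟫_A) :=
    (CStarModule.continuous_inner (A := A) (E := E)).tendsto (x, T' y) |>.comp
      (tendsto_const_nhds.prodMk_nhds
        (((ContinuousLinearMap.apply ℂ E y).continuous.tendsto T').comp hT'))
  exact tendsto_nhds_unique (e1.congr fun n => inner_left (u n) x y) e2

instance [CompleteSpace E] : CStarAlgebra (Adjointable A E) where
  toCompleteSpace := isClosed_adjointableSubalgebra.completeSpace_coe

/-- The rank-one operator `x y⋆ : z ↦ x ⟨y, z⟩`. -/
def rankOne [IsBoundedSMul A E] [IsScalarTower ℂ A E] (x y : E) : Adjointable A E :=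
  ⟨((ContinuousLinearMap.lsmul ℂ A).flip x : A →L[ℂ] E).comp (CStarModule.innerSL y),
    ((ContinuousLinearMap.lsmul ℂ A).flip y : A →L[ℂ] E).comp (CStarModule.innerSL x), fun z w => by
    simp [CStarModule.innerSL_apply]⟩

theorem rankOne_apply [IsBoundedSMul A E] [IsScalarTower ℂ A E] (x y z : E) :
    (rankOne x y : Adjointable A E) z = ⟪y, z⟫_A • x := rfl

end Adjointable

section Compact

open Adjointable

variable [IsBoundedSMul A E] [IsScalarTower ℂ A E]

theorem rankOne_mul_rankOne (x y x' y' : E) :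
    (rankOne x y * rankOne x' y' : Adjointable A E) = rankOne (⟪y, x'⟫_A • x) y' :=
  Adjointable.ext fun z => by
    rw [mul_apply]
    simp [rankOne_apply, mul_smul]

theorem star_rankOne (x y : E) : star (rankOne x y : Adjointable A E) = rankOne y x :=
  star_eq fun z w => by simp [rankOne_apply]

/-- The linear span of the rank-one operators `x y⋆` with `x, y` in the submodule `F`. -/
def finiteRankOn (F : Submodule A E) : NonUnitalStarSubalgebra ℂ (Adjointable A E) where
  toSubmodule := Submodule.span ℂ {T | ∃ x ∈ F, ∃ y ∈ F, T = rankOne x y}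
  mul_mem' {S T} hS hT := by
    change S * T ∈ Submodule.span ℂ _
    induction hS, hT using Submodule.span_induction₂ with
    | mem_mem S T hS hT =>
      obtain ⟨x, hx, y, hy, rfl⟩ := hS
      obtain ⟨x', hx', y', hy', rfl⟩ := hT
      exact Submodule.subset_span ⟨_, F.smul_mem _ hx, y', hy', rankOne_mul_rankOne x y x' y'⟩
    | zero_left => simp
    | zero_right => simp
    | add_left _ _ _ _ _ _ h1 h2 => rw [add_mul]; exact add_mem h1 h2
    | add_right _ _ _ _ _ _ h1 h2 => rw [mul_add]; exact add_mem h1 h2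
    | smul_left c _ _ _ _ h => rw [smul_mul_assoc]; exact Submodule.smul_mem _ c h
    | smul_right c _ _ _ _ h => rw [mul_smul_comm]; exact Submodule.smul_mem _ c h
  star_mem' {T} hT := by
    change star T ∈ Submodule.span ℂ _
    induction hT using Submodule.span_induction with
    | mem T hT =>
      obtain ⟨x, hx, y, hy, rfl⟩ := hT
      exact Submodule.subset_span ⟨y, hy, x, hx, star_rankOne x y⟩
    | zero => simp
    | add _ _ _ _ h1 h2 => rw [star_add]; exact add_mem h1 h2
    | smul c _ _ h => rw [star_smul]; exact Submodule.smul_mem _ _ h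

variable [CompleteSpace E]

/-- The closed linear span of the rank-one operators `x y⋆` with `x, y` in the submodule `F`.
For closed `F` this is the canonical copy of the compact operators on `F` inside the adjointable
operators on `E`. -/
def compactOn (F : Submodule A E) : NonUnitalStarSubalgebra ℂ (Adjointable A E) :=
  (finiteRankOn F).topologicalClosure

variable (A E)

/-- The C⋆-algebra `K(E)` of compact operators on the Hilbert `A`-module `E`: the closed linear
span of the rank-one operators. -/
def Compact : Type _ := compactOn (⊤ : Submodule A E)

instance : NonUnitalCStarAlgebra (Compact A E) :=
  NonUnitalStarSubalgebra.nonUnitalCStarAlgebra (compactOn (⊤ : Submodule A E))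
    (h_closed := NonUnitalStarSubalgebra.isClosed_topologicalClosure _)

variable {A E}

/-- The inclusion of the compact operators into the adjointable operators. -/
def Compact.toAdjointable : Compact A E →⋆ₙₐ[ℂ] Adjointable A E :=
  NonUnitalStarSubalgebraClass.subtype (compactOn (⊤ : Submodule A E))

/-- `K(F)`, as a subalgebra of `K(E)`, for a closed submodule `F` of `E`. -/
def Compact.sub (F : Submodule A E) : NonUnitalStarSubalgebra ℂ (Compact A E) :=
  (compactOn F).comap Compact.toAdjointable

end Compact

end Operators

/-! ### The standard Hilbert module over a commutative C⋆-algebra -/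

section Standard

variable (A S : Type*) [CommCStarAlgebra A] [PartialOrder A] [StarOrderedRing A]

variable {A} in
theorem norm_sum_inner_le {S : Type*} (x y : S → A) (T : Finset S) :
    ‖∑ s ∈ T, star (x s) * y s‖ ≤
      √‖∑ s ∈ T, star (x s) * x s‖ * √‖∑ s ∈ T, star (y s) * y s‖ := by
  let X : WithCStarModule A (T → A) := (WithCStarModule.equiv A (T → A)).symm fun s => x s
  let Y : WithCStarModule A (T → A) := (WithCStarModule.equiv A (T → A)).symm fun s => y s
  have h := CStarModule.norm_inner_le (A := A) (WithCStarModule A (T → A))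
    (x := X) (y := Y)
  rw [WithCStarModule.pi_norm, WithCStarModule.pi_norm, WithCStarModule.pi_inner] at h
  rw [← Finset.sum_attach T, ← Finset.sum_attach T, ← Finset.sum_attach T]
  simpa [X, Y, WithCStarModule.inner_def, mul_comm] using h

variable {A} in
theorem sqrt_norm_sum_add_le {S : Type*} (x y : S → A) (T : Finset S) :
    √‖∑ s ∈ T, star (x s + y s) * (x s + y s)‖ ≤
      √‖∑ s ∈ T, star (x s) * x s‖ + √‖∑ s ∈ T, star (y s) * y s‖ := by
  let X : WithCStarModule A (T → A) := (WithCStarModule.equiv A (T → A)).symm fun s => x s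
  let Y : WithCStarModule A (T → A) := (WithCStarModule.equiv A (T → A)).symm fun s => y s
  have h := CStarModule.norm_triangle A X Y
  rw [WithCStarModule.pi_norm, WithCStarModule.pi_norm, WithCStarModule.pi_norm] at h
  rw [← Finset.sum_attach T, ← Finset.sum_attach T, ← Finset.sum_attach T]
  simpa [X, Y, WithCStarModule.inner_def, mul_comm] using h

variable {A S}

theorem summable_star_mul_self_iff {x : S → A} :
    (Summable fun s => star (x s) * x s) ↔
      ∀ ε > 0, ∃ s : Finset S, ∀ t : Finset S, Disjoint t s →
        √‖∑ i ∈ t, star (x i) * x i‖ < ε := by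
  rw [summable_iff_vanishing_norm]
  constructor
  · intro h ε hε
    obtain ⟨s, hs⟩ := h (ε ^ 2) (by positivity)
    exact ⟨s, fun t ht => (Real.sqrt_lt' hε).2 (hs t ht)⟩
  · intro h ε hε
    obtain ⟨s, hs⟩ := h (√ε) (Real.sqrt_pos.2 hε)
    exact ⟨s, fun t ht => (Real.sqrt_lt_sqrt_iff (norm_nonneg _)).1 (hs t ht)⟩

theorem summable_star_mul {x y : S → A} (hx : Summable fun s => star (x s) * x s)
    (hy : Summable fun s => star (y s) * y s) : Summable fun s => star (x s) * y s := by
  rw [summable_star_mul_self_iff] at hx hy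
  rw [summable_iff_vanishing_norm]
  intro ε hε
  classical
  obtain ⟨s, hs⟩ := hx ε hε
  obtain ⟨s', hs'⟩ := hy 1 one_pos
  refine ⟨s ∪ s', fun t ht => (norm_sum_inner_le x y t).trans_lt ?_⟩
  rw [Finset.disjoint_union_right] at ht
  have h1 := hs t ht.1
  have h2 := hs' t ht.2
  nlinarith [Real.sqrt_nonneg ‖∑ i ∈ t, star (x i) * x i‖,
    Real.sqrt_nonneg ‖∑ i ∈ t, star (y i) * y i‖]

variable (A S)

/-- The families `(b_s)` in `A` such that `∑ b_s⋆ b_s` converges in norm over the finite subsets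
of `S`. -/
def standardSubmodule : Submodule A (S → A) where
  carrier := {b | Summable fun s => star (b s) * b s}
  zero_mem' := by
    change Summable fun s : S => star (0 : A) * 0
    simp
  add_mem' {x y} hx hy := by
    have hx' := summable_star_mul_self_iff.1 hx
    have hy' := summable_star_mul_self_iff.1 hy
    refine summable_star_mul_self_iff.2 fun ε hε => ?_
    classical
    obtain ⟨s, hs⟩ := hx' (ε / 2) (half_pos hε)
    obtain ⟨s', hs'⟩ := hy' (ε / 2) (half_pos hε)
    refine ⟨s ∪ s', fun t ht => (sqrt_norm_sum_add_le x y t).trans_lt ?_⟩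
    rw [Finset.disjoint_union_right] at ht
    linarith [hs t ht.1, hs' t ht.2]
  smul_mem' a x hx := by
    have h : Summable fun s => star a * a * (star (x s) * x s) := Summable.mul_left _ hx
    refine h.congr fun s => ?_
    simp only [Pi.smul_apply, smul_eq_mul, star_mul]
    ring

/-- The standard Hilbert `A`-module over the set `S`. -/
def Standard : Type _ := standardSubmodule A S

instance : AddCommGroup (Standard A S) := inferInstanceAs (AddCommGroup (standardSubmodule A S))

instance : Module A (Standard A S) := inferInstanceAs (Module A (standardSubmodule A S))

instance : Module ℂ (Standard A S) := inferInstanceAs (Module ℂ (standardSubmodule A S))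

instance : IsScalarTower ℂ A (Standard A S) :=
  inferInstanceAs (IsScalarTower ℂ A (standardSubmodule A S))

namespace Standard

variable {A S}

/-- The components of an element of the standard Hilbert module. -/
def coord (x : Standard A S) : S → A := x.1

theorem summable (x : Standard A S) : Summable fun s => star (x.coord s) * x.coord s := x.2

theorem summable_inner (x y : Standard A S) : Summable fun s => star (x.coord s) * y.coord s :=
  summable_star_mul x.2 y.2

theorem ext {x y : Standard A S} (h : ∀ s, x.coord s = y.coord s) : x = y :=
  Subtype.ext (funext h)

@[simp] theorem coord_zero (s : S) : (0 : Standard A S).coord s = 0 := rfl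
@[simp] theorem coord_add (x y : Standard A S) (s : S) :
    (x + y).coord s = x.coord s + y.coord s := rfl
@[simp] theorem coord_sub (x y : Standard A S) (s : S) :
    (x - y).coord s = x.coord s - y.coord s := rfl
@[simp] theorem coord_smul (a : A) (x : Standard A S) (s : S) :
    (a • x).coord s = a * x.coord s := rfl
@[simp] theorem coord_smul_complex (c : ℂ) (x : Standard A S) (s : S) :
    (c • x).coord s = c • x.coord s := rfl

/-- The `A`-valued inner product `⟨x, y⟩ = ∑ x_s⋆ y_s`. -/
instance : Inner A (Standard A S) := ⟨fun x y => ∑' s, star (x.coord s) * y.coord s⟩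

theorem inner_def (x y : Standard A S) : ⟪x, y⟫_A = ∑' s, star (x.coord s) * y.coord s := rfl

instance : Norm (Standard A S) := ⟨fun x => √‖⟪x, x⟫_A‖⟩

theorem norm_def (x : Standard A S) : ‖x‖ = √‖∑' s, star (x.coord s) * x.coord s‖ := rfl

instance : CStarModule A (Standard A S) where
  inner_add_right {x y z} := by
    simp only [inner_def, coord_add, mul_add]
    exact (summable_inner x y).tsum_add (summable_inner x z)
  inner_self_nonneg {x} := tsum_nonneg fun s => star_mul_self_nonneg _
  inner_self {x} := by
    refine ⟨fun h => ext fun s => ?_, fun h => by simp [h, inner_def]⟩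
    have h1 := (summable x).le_tsum s fun t _ => star_mul_self_nonneg _
    rw [← inner_def, h] at h1
    exact (CStarRing.star_mul_self_eq_zero_iff _).1 (le_antisymm h1 (star_mul_self_nonneg _))
  inner_op_smul_right {a x y} := by
    simp only [inner_def, coord_smul]
    rw [← (summable_inner x y).tsum_mul_left]
    exact tsum_congr fun s => by ring
  inner_smul_right_complex {c x y} := by
    simp only [inner_def, coord_smul_complex, mul_smul_comm]
    exact (summable_inner x y).tsum_const_smul c
  star_inner x y := by
    simp only [inner_def]
    rw [tsum_star]
    exact tsum_congr fun s => by simp [mul_comm]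
  norm_eq_sqrt_norm_inner_self x := rfl

instance : NormedAddCommGroup (Standard A S) := CStarModule.normedAddCommGroup A

instance : NormedSpace ℂ (Standard A S) := .ofCore (CStarModule.normedSpaceCore A)

instance : IsBoundedSMul A (Standard A S) :=
  IsBoundedSMul.of_norm_smul_le fun a x => by
    refine abs_le_of_sq_le_sq' ?_ (by positivity) |>.2
    rw [CStarModule.norm_sq_eq A, mul_pow, CStarModule.norm_sq_eq A (x := x),
      CStarModule.inner_op_smul_right, CStarModule.inner_op_smul_left]
    calc ‖a * (⟪x, x⟫_A * star a)‖ ≤ ‖a‖ * (‖⟪x, x⟫_A‖ * ‖star a‖) :=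
          (norm_mul_le _ _).trans (by gcongr; exact norm_mul_le _ _)
      _ = ‖a‖ ^ 2 * ‖⟪x, x⟫_A‖ := by rw [norm_star]; ring

theorem sqrt_norm_sum_le (x : Standard A S) (T : Finset S) :
    √‖∑ s ∈ T, star (x.coord s) * x.coord s‖ ≤ ‖x‖ := by
  rw [norm_def]
  refine Real.sqrt_le_sqrt (CStarAlgebra.norm_le_norm_of_nonneg_of_le
    (Finset.sum_nonneg fun s _ => star_mul_self_nonneg _) ?_)
  exact (summable x).sum_le_tsum T fun s _ => star_mul_self_nonneg _

theorem norm_le_of_sum_le {x : Standard A S} {C : ℝ}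
    (h : ∀ T : Finset S, √‖∑ s ∈ T, star (x.coord s) * x.coord s‖ ≤ C) : ‖x‖ ≤ C :=
  le_of_tendsto ((continuous_norm.sqrt.tendsto _).comp (summable x).hasSum)
    (Filter.Eventually.of_forall h)

theorem norm_coord_le (x : Standard A S) (s : S) : ‖x.coord s‖ ≤ ‖x‖ := by
  have h := sqrt_norm_sum_le x {s}
  rwa [Finset.sum_singleton, CStarRing.norm_star_mul_self,
    Real.sqrt_mul_self (norm_nonneg _)] at h

instance : CompleteSpace (Standard A S) := by
  refine Metric.complete_of_cauchySeq_tendsto fun u hu => ?_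
  have hc : ∀ s, ∃ a, Filter.Tendsto (fun n => (u n).coord s) Filter.atTop (nhds a) := by
    intro s
    refine cauchySeq_tendsto_of_complete ?_
    rw [Metric.cauchySeq_iff] at hu ⊢
    intro ε hε
    obtain ⟨N, hN⟩ := hu ε hε
    refine ⟨N, fun m hm n hn => ?_⟩
    rw [dist_eq_norm, ← coord_sub]
    exact (norm_coord_le _ s).trans_lt (by rw [← dist_eq_norm]; exact hN m hm n hn)
  choose x hx using hc
  have key : ∀ ε > 0, ∃ N, ∀ n ≥ N, ∀ T : Finset S,
      √‖∑ s ∈ T, star ((u n).coord s - x s) * ((u n).coord s - x s)‖ ≤ ε := by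
    intro ε hε
    obtain ⟨N, hN⟩ := Metric.cauchySeq_iff.1 hu ε hε
    refine ⟨N, fun n hn T => ?_⟩
    have ht : Filter.Tendsto (fun m => √‖∑ s ∈ T, star ((u n).coord s - (u m).coord s) *
        ((u n).coord s - (u m).coord s)‖) Filter.atTop
        (nhds √‖∑ s ∈ T, star ((u n).coord s - x s) * ((u n).coord s - x s)‖) :=
      (tendsto_finsetSum T fun s _ => ((tendsto_const_nhds.sub (hx s)).star.mul
        (tendsto_const_nhds.sub (hx s)))).norm.sqrt
    refine le_of_tendsto ht (Filter.eventually_atTop.2 ⟨N, fun m hm => ?_⟩)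
    exact (sqrt_norm_sum_le (u n - u m) T).trans (by rw [← dist_eq_norm]; exact (hN n hn m hm).le)
  have hmem : Summable fun s => star (x s) * x s := by
    rw [summable_star_mul_self_iff]
    intro ε hε
    obtain ⟨N, hN⟩ := key (ε / 2) (half_pos hε)
    obtain ⟨s, hs⟩ := summable_star_mul_self_iff.1 (summable (u N)) (ε / 2) (half_pos hε)
    refine ⟨s, fun t ht => ?_⟩
    have h1 := sqrt_norm_sum_add_le (fun s => x s - (u N).coord s) (u N).coord t
    have h2 := hN N le_rfl t
    have h3 : ∑ s ∈ t, star (x s - (u N).coord s) * (x s - (u N).coord s) =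
        ∑ s ∈ t, star ((u N).coord s - x s) * ((u N).coord s - x s) :=
      Finset.sum_congr rfl fun s _ => by
        rw [← neg_sub (x s), star_neg, neg_mul_neg]
    simp only [sub_add_cancel, h3] at h1
    linarith [hs t ht]
  let X : Standard A S := ⟨x, hmem⟩
  refine ⟨X, Metric.tendsto_atTop.2 fun ε hε => ?_⟩
  obtain ⟨N, hN⟩ := key (ε / 2) (half_pos hε)
  refine ⟨N, fun n hn => ?_⟩
  rw [dist_eq_norm]
  exact (norm_le_of_sum_le (x := u n - X) (hN n hn)).trans_lt (half_lt_self hε)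

/-- The family with the entry `a` at the index `s` and `0` elsewhere. -/
def single [DecidableEq S] (s : S) (a : A) : Standard A S :=
  ⟨Pi.single s a, summable_of_ne_finset_zero (s := {s}) fun t ht => by
    rw [Pi.single_eq_of_ne (by simpa using ht), mul_zero]⟩

end Standard

end Standard

end HilbertModule

/-! ### The example -/

open HilbertModule

/-- `C[0,1]`. -/
abbrev CI : Type := C(unitInterval, ℂ)

/-- The module `E = C[0,1] ⊕ (C[0,1]^ℕ)^∞`, that is, the standard Hilbert `C[0,1]`-module over
the index set `{0} ∪ (ℕ × ℕ)`; `none` is the index `0`. -/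
abbrev ModuleE : Type := Standard CI (Option (ℕ × ℕ))

/-- The element `ζ_{k,ℓ}` with entry `2⁻ᵏ ψ_{k,ℓ}⋆` at `0`, entry `-1` at `(k, ℓ)` and entry `0`
elsewhere. Counting starts at `0`, hence the exponent `k + 1`. -/
def zeta (ψ : ℕ → ℕ → CI) (k l : ℕ) : ModuleE :=
  Standard.single none ((2 ^ (k + 1) : ℂ)⁻¹ • star (ψ k l)) - Standard.single (some (k, l)) 1

/-- The closed submodule `F` of `E` generated by the `ζ_{k,ℓ}`. -/
def ModuleF (ψ : ℕ → ℕ → CI) : Submodule CI ModuleE :=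
  (Submodule.span CI {z | ∃ k l, z = zeta ψ k l}).topologicalClosure

end

universe u

/-! The submodule `F` has no nonzero orthogonal vector in `E`, yet it is annihilated in the limit by
a bounded family of functionals; this gap gives the example. A vector `x` orthogonal to all
`ζ_{k,l}` must have `x_{k,l} = 2^{-(k+1)} ψ_{k,l} x_0`, so `⟨x,x⟩ = (1 + h)|x_0|²` with `h = ∑
4^{-(k+1)} χ_{[0,q_k)}`. The left side is continuous and `h` jumps at every `q_n`, so `x_0` vanishes
on a dense set and `x = 0` (`eq_zero_of_inner_zeta_eq_zero`). If `T` kills `K(F)` from the left,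
then `T ζ = 0` for every generator, so the range of `T⋆` is orthogonal to `F` and `T = 0`. The
formal normal `(1, 2^{-(k+1)} ψ_{k,l})` thus lies outside `E`, but its finite truncations `u_N` have
norm at most `√2` and `⟨u_N, ·⟩` tends to `0` pointwise on `F` (`tendsto_inner_truncatedNormal`).
With `e` the unit vector at the index `0`, the operators `e u_N⋆` are bounded, tend to `0` in norm
against `K(F)`, and fix `e e⋆` under left multiplication. A representation that is nondegenerate on
`K(F)` therefore kills `e e⋆` and is not faithful (`not_actsNondegenerately_of_tendsto_zero`).
Heredity follows from `K(F) K(E) K(F) ⊆ K(F)` by an approximate unit argument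
(`isHereditaryCStarSubalgebra_of_mul_mul_mem`). -/

open Filter Topology HilbertModule

/-! ### A criterion for heredity -/

/-- If `0 ≤ a ≤ b`, then `√a (1 - e)` is controlled by `b (1 - e)`. -/
theorem norm_sqrt_sub_mul_sq_le {A : Type*} [NonUnitalCStarAlgebra A] [PartialOrder A]
    [StarOrderedRing A] {a b e : A} (ha : 0 ≤ a) (hab : a ≤ b) (he : ‖e‖ ≤ 1) :
    ‖CFC.sqrt a - CFC.sqrt a * e‖ ^ 2 ≤ 2 * ‖b - b * e‖ := by
  have hs : star (CFC.sqrt a) = CFC.sqrt a := (CFC.sqrt_nonneg a).isSelfAdjoint.star_eq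
  -- `A` may lack a unit, so `1 - e` and the conjugation of `a ≤ b` by it live in the unitization.
  let f : Unitization ℂ A := 1 - (e : Unitization ℂ A)
  have hf : ‖star f‖ ≤ 2 := by
    rw [norm_star]
    refine (norm_sub_le _ _).trans ?_
    rw [Unitization.norm_inr, norm_one]
    linarith
  have hle : star f * (a : Unitization ℂ A) * f ≤ star f * (b : Unitization ℂ A) * f :=
    star_left_conjugate_le_conjugate
      ((Unitization.inr_le_iff a b (.of_nonneg ha) (.of_nonneg (ha.trans hab))).2 hab) f
  have h0 : 0 ≤ star f * (a : Unitization ℂ A) * f :=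
    star_left_conjugate_nonneg (Unitization.inr_nonneg_iff.2 ha) f
  have h1 : ((CFC.sqrt a - CFC.sqrt a * e : A) : Unitization ℂ A) = (CFC.sqrt a : A) * f := by
    simp [f, mul_sub]
  have h2 : ((b - b * e : A) : Unitization ℂ A) = b * f := by
    simp [f, mul_sub]
  calc ‖CFC.sqrt a - CFC.sqrt a * e‖ ^ 2
      = ‖star f * (a : Unitization ℂ A) * f‖ := by
        rw [← Unitization.norm_inr (𝕜 := ℂ), h1, sq, ← CStarRing.norm_star_mul_self, star_mul,
          ← Unitization.inr_star, hs, mul_assoc, ← mul_assoc _ _ f, ← Unitization.inr_mul,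
          CFC.sqrt_mul_sqrt_self a ha, mul_assoc]
    _ ≤ ‖star f * (b : Unitization ℂ A) * f‖ := CStarAlgebra.norm_le_norm_of_nonneg_of_le h0 hle
    _ ≤ ‖star f‖ * ‖(b : Unitization ℂ A) * f‖ := by rw [mul_assoc]; exact norm_mul_le _ _
    _ ≤ 2 * ‖b - b * e‖ := by
        rw [← Unitization.norm_inr (𝕜 := ℂ) (b - b * e), h2]
        gcongr

/-- A closed subalgebra `B` of `A` with `B A B ⊆ B` is hereditary. -/
theorem isHereditaryCStarSubalgebra_of_mul_mul_mem {A : Type*} [NonUnitalCStarAlgebra A]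
    {B : NonUnitalStarSubalgebra ℂ A} (hB : IsClosed (B : Set A))
    (h : ∀ b ∈ B, ∀ a, ∀ c ∈ B, b * a * c ∈ B) : IsHereditaryCStarSubalgebra B := by
  refine ⟨hB, ?_⟩
  let := CStarAlgebra.spectralOrder A
  have := CStarAlgebra.spectralOrderedRing A
  intro a b ha hab hb
  -- The approximate unit is taken in `B` itself; `√a` need not be known to lie in `B`.
  let : NonUnitalCStarAlgebra B :=
    NonUnitalStarSubalgebra.nonUnitalCStarAlgebra B (h_closed := hB)
  let := CStarAlgebra.spectralOrder B
  have := CStarAlgebra.spectralOrderedRing B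
  have hl := CStarAlgebra.increasingApproximateUnit B
  set l := CStarAlgebra.approximateUnit B
  have := hl.neBot
  have h1 : Tendsto (fun e : B => 2 * ‖b - b * (e : A)‖) l (𝓝 0) := by
    have := (continuous_subtype_val.tendsto _).comp (hl.tendsto_mul_left ⟨b, hb⟩)
    have h2 : Tendsto (fun e : B => b * (e : A)) l (𝓝 b) := this
    simpa using ((tendsto_const_nhds (x := b)).sub h2).norm.const_mul 2
  have h2 : Tendsto (fun e : B => ‖CFC.sqrt a - CFC.sqrt a * (e : A)‖ ^ 2) l (𝓝 0) := by
    refine squeeze_zero' (.of_forall fun _ => by positivity) ?_ h1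
    filter_upwards [hl.eventually_norm] with e he
    exact norm_sqrt_sub_mul_sq_le ha hab he
  have h3 : Tendsto (fun e : B => CFC.sqrt a * (e : A)) l (𝓝 (CFC.sqrt a)) := by
    have h4 : Tendsto (fun e : B => ‖CFC.sqrt a - CFC.sqrt a * (e : A)‖) l (𝓝 0) := by
      simpa using h2.sqrt
    simpa using (tendsto_const_nhds (x := CFC.sqrt a)).sub (tendsto_zero_iff_norm_tendsto_zero.2 h4)
  -- Since `(√a e)⋆(√a e) = e⋆ a e` lies in `B A B`, the element `a` is a limit of elements of `B`.
  have h4 : Tendsto (fun e : B => star (e : A) * a * (e : A)) l (𝓝 a) := by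
    have h5 := h3.star.mul h3
    have hs : star (CFC.sqrt a) = CFC.sqrt a := (CFC.sqrt_nonneg a).isSelfAdjoint.star_eq
    rw [hs, CFC.sqrt_mul_sqrt_self a ha] at h5
    refine h5.congr fun e => ?_
    rw [star_mul, hs, mul_assoc, ← mul_assoc (CFC.sqrt a), CFC.sqrt_mul_sqrt_self a ha, mul_assoc]
  exact hB.mem_of_tendsto h4 (.of_forall fun e => h _ (star_mem e.2) a _ e.2)

/-! ### An obstruction to nondegeneracy -/

/-- For a bounded family of operators, the vectors on which it tends to `0` form a closed set. -/
theorem tendsto_zero_of_mem_closure {ι X Y : Type*} [NormedAddCommGroup X] [NormedSpace ℂ X]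
    [NormedAddCommGroup Y] [NormedSpace ℂ Y] {l : Filter ι} {D : ι → X →L[ℂ] Y} {M : ℝ}
    (hM : ∀ i, ‖D i‖ ≤ M) {s : Set X} (hs : ∀ x ∈ s, Tendsto (fun i => D i x) l (𝓝 0)) {x : X}
    (hx : x ∈ closure s) : Tendsto (fun i => D i x) l (𝓝 0) := by
  rw [Metric.tendsto_nhds]
  intro ε hε
  -- `M` may be zero, or negative when the family is empty; `|M| + 1` is a bound one can divide by.
  have hM' : 0 < |M| + 1 := by positivity
  obtain ⟨y, hy, hxy⟩ := Metric.mem_closure_iff.1 hx (ε / 2 / (|M| + 1)) (by positivity)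
  filter_upwards [Metric.tendsto_nhds.1 (hs y hy) (ε / 2) (half_pos hε)] with i hi
  rw [dist_zero_right] at hi ⊢
  rw [dist_eq_norm, lt_div_iff₀ hM'] at hxy
  have h1 : ‖D i (x - y)‖ ≤ ‖x - y‖ * (|M| + 1) := by
    refine ((D i).le_opNorm _).trans ?_
    rw [mul_comm]
    gcongr
    linarith [hM i, le_abs_self M]
  calc ‖D i x‖ = ‖D i (x - y) + D i y‖ := by rw [← map_add, sub_add_cancel]
    _ ≤ ‖D i (x - y)‖ + ‖D i y‖ := norm_add_le _ _
    _ < ε := by linarith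

/-- If a bounded family in `A` tends to `0` on `B` but fixes some `θ ≠ 0`, then `B` does not act
nondegenerately in any faithful representation of `A`. -/
theorem not_actsNondegenerately_of_tendsto_zero {A ι : Type*} [NonUnitalCStarAlgebra A]
    {B : NonUnitalStarSubalgebra ℂ A} {l : Filter ι} [l.NeBot] {D : ι → A} {M : ℝ}
    (hM : ∀ i, ‖D i‖ ≤ M) (hD : ∀ b ∈ B, Tendsto (fun i => D i * b) l (𝓝 0)) {θ : A}
    (hθ : θ ≠ 0) (hDθ : ∀ i, D i * θ = θ)
    {H : Type*} [NormedAddCommGroup H] [InnerProductSpace ℂ H] [CompleteSpace H]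
    (π : A →⋆ₙₐ[ℂ] (H →L[ℂ] H)) (hπ : Function.Injective π) : ¬ ActsNondegenerately π B := by
  intro hnd
  have hcont : Continuous π := AddMonoidHomClass.continuous_of_bound π 1 fun a => by
    simpa using NonUnitalStarAlgHom.norm_apply_le π a
  -- Strong convergence holds on the vectors `π(b) h` because `π(D i) π(b) h = π(D i * b) h`;
  -- boundedness carries it to their closed span, which is `H`.
  have key : ∀ v : H, Tendsto (fun i => π (D i) v) l (𝓝 0) := by
    intro v
    have hv : v ∈ closure
        (Submodule.span ℂ {v : H | ∃ b ∈ B, ∃ h : H, π b h = v} : Set H) := by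
      rw [← Submodule.topologicalClosure_coe, hnd]
      trivial
    refine tendsto_zero_of_mem_closure (D := fun i => π (D i)) (M := M)
      (fun i => (NonUnitalStarAlgHom.norm_apply_le π _).trans (hM i)) (fun x hx => ?_) hv
    induction hx using Submodule.span_induction with
    | mem x hx =>
      obtain ⟨b, hb, h, rfl⟩ := hx
      have h1 := (hcont.tendsto 0).comp (hD b hb)
      rw [map_zero] at h1
      have h2 := ((ContinuousLinearMap.apply ℂ H h).continuous.tendsto 0).comp h1
      rw [map_zero] at h2
      refine h2.congr fun i => ?_
      simp [map_mul]
    | zero => simp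
    | add x y _ _ h1 h2 => simpa using h1.add h2
    | smul c x _ h1 => simpa using h1.const_smul c
  refine hθ (hπ ?_)
  rw [map_zero]
  ext v
  -- The family `π(D i) π(θ) v` is constantly `π(θ) v` and also tends to `0`.
  refine tendsto_nhds_unique ((tendsto_const_nhds (x := π θ v) (f := l)).congr fun i => ?_)
    (key (π θ v))
  rw [← mul_apply_eq_comp, ← map_mul, hDθ]

/-! ### Compact operators on a Hilbert module -/

namespace HilbertModule

open Adjointable

section General

variable {A E : Type*} [CStarAlgebra A] [PartialOrder A] [StarOrderedRing A]
  [NormedAddCommGroup E] [NormedSpace ℂ E] [Module A E] [CStarModule A E]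
  [IsBoundedSMul A E] [IsScalarTower ℂ A E]

/-- This rests on the `A`-linearity of `T`: elements of `Adjointable` are only given as `ℂ`-linear
maps, and moving `T` across the inner product supplies the rest. -/
theorem mul_rankOne (T : Adjointable A E) (x y : E) :
    T * rankOne x y = rankOne (T x) y := by
  refine Adjointable.ext fun z => eq_of_inner (A := A) fun w => ?_
  rw [mul_apply, inner_right, rankOne_apply, rankOne_apply, CStarModule.inner_op_smul_right,
    CStarModule.inner_op_smul_right, inner_right]

theorem norm_rankOne_le (x y : E) : ‖(rankOne x y : Adjointable A E)‖ ≤ ‖x‖ * ‖y‖ := by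
  rw [← norm_toCLM]
  refine ContinuousLinearMap.opNorm_le_bound _ (by positivity) fun z => ?_
  rw [rankOne_apply]
  calc ‖⟪y, z⟫_A • x‖ ≤ ‖⟪y, z⟫_A‖ * ‖x‖ := norm_smul_le _ _
    _ ≤ ‖y‖ * ‖z‖ * ‖x‖ := by gcongr; exact CStarModule.norm_inner_le E
    _ = ‖x‖ * ‖y‖ * ‖z‖ := by ring

/-- The middle factor is absorbed into a scalar of `A`: `x y⋆ R x' y'⋆ = (⟨y, R x'⟩ x) y'⋆`, and `F`
is a submodule. No compactness of `R` is needed. -/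
theorem mul_mul_mem_finiteRankOn {F : Submodule A E} {S T : Adjointable A E}
    (hS : S ∈ finiteRankOn F) (R : Adjointable A E) (hT : T ∈ finiteRankOn F) :
    S * R * T ∈ finiteRankOn F := by
  change S * R * T ∈ Submodule.span ℂ _
  change S ∈ Submodule.span ℂ _ at hS
  change T ∈ Submodule.span ℂ _ at hT
  induction hS, hT using Submodule.span_induction₂ with
  | mem_mem S T hS hT =>
    obtain ⟨x, hx, y, hy, rfl⟩ := hS
    obtain ⟨x', hx', y', hy', rfl⟩ := hT
    rw [mul_assoc, mul_rankOne, rankOne_mul_rankOne]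
    exact Submodule.subset_span ⟨_, F.smul_mem _ hx, y', hy', rfl⟩
  | zero_left => simp
  | zero_right => simp
  | add_left _ _ _ _ _ _ h1 h2 => rw [add_mul, add_mul]; exact add_mem h1 h2
  | add_right _ _ _ _ _ _ h1 h2 => rw [mul_add]; exact add_mem h1 h2
  | smul_left c _ _ _ _ h =>
    rw [smul_mul_assoc, smul_mul_assoc]; exact Submodule.smul_mem _ c h
  | smul_right c _ _ _ _ h => rw [mul_smul_comm]; exact Submodule.smul_mem _ c h

variable [CompleteSpace E]

theorem rankOne_mem_compactOn {F : Submodule A E} {x y : E} (hx : x ∈ F) (hy : y ∈ F) :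
    rankOne x y ∈ compactOn F :=
  subset_closure (Submodule.subset_span ⟨x, hx, y, hy, rfl⟩)

theorem mul_mul_mem_compactOn {F : Submodule A E} {S T : Adjointable A E}
    (hS : S ∈ compactOn F) (R : Adjointable A E) (hT : T ∈ compactOn F) :
    S * R * T ∈ compactOn F :=
  map_mem_closure₂ (f := fun S T => S * R * T) (by fun_prop) hS hT
    fun _ hS _ hT => mul_mul_mem_finiteRankOn hS R hT

namespace Compact

/-- The rank-one operator `x y⋆` as a compact operator. -/
noncomputable def rankOne (x y : E) : Compact A E :=
  ⟨Adjointable.rankOne x y, rankOne_mem_compactOn trivial trivial⟩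

@[simp]
theorem toAdjointable_rankOne (x y : E) :
    toAdjointable (rankOne x y : Compact A E) = Adjointable.rankOne x y := rfl

theorem isometry_toAdjointable : Isometry (toAdjointable : Compact A E → Adjointable A E) :=
  isometry_subtype_coe

theorem toAdjointable_injective :
    Function.Injective (toAdjointable : Compact A E → Adjointable A E) :=
  isometry_toAdjointable.injective

theorem mem_sub_iff {F : Submodule A E} {T : Compact A E} :
    T ∈ sub F ↔ toAdjointable T ∈ compactOn F := Iff.rfl

theorem isHereditaryCStarSubalgebra_sub (F : Submodule A E) :
    IsHereditaryCStarSubalgebra (sub F) := by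
  refine isHereditaryCStarSubalgebra_of_mul_mul_mem ?_ fun S hS R T hT => ?_
  · exact (NonUnitalStarSubalgebra.isClosed_topologicalClosure (finiteRankOn F)).preimage
      isometry_toAdjointable.continuous
  · rw [mem_sub_iff, map_mul, map_mul]
    exact mul_mul_mem_compactOn hS _ hT

/-- If the functionals `⟨u i, ·⟩` are bounded and tend to `0` on `F`, then the operators
`e (u i)⋆` tend to `0` on `K(F)`. -/
theorem tendsto_rankOne_mul_zero {ι : Type*} {l : Filter ι} {F : Submodule A E} {u : ι → E}
    {M : ℝ} (hM : ∀ i, ‖u i‖ ≤ M) (hu : ∀ x ∈ F, Tendsto (fun i => ⟪u i, x⟫_A) l (𝓝 0)) (e : E)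
    {T : Compact A E} (hT : T ∈ sub F) :
    Tendsto (fun i => rankOne e (u i) * T) l (𝓝 0) := by
  rw [isometry_toAdjointable.isEmbedding.tendsto_nhds_iff, map_zero]
  -- Left multiplications by `e (u i)⋆` form a bounded family of operators, so finite-rank `T`
  -- suffice.
  refine tendsto_zero_of_mem_closure (M := ‖e‖ * M)
    (D := fun i => ContinuousLinearMap.mul ℂ (Adjointable A E) (Adjointable.rankOne e (u i)))
    (fun i => ?_) (fun S hS => ?_) hT
  · refine (ContinuousLinearMap.opNorm_mul_apply_le ℂ _ _).trans ((norm_rankOne_le _ _).trans ?_)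
    gcongr
    exact hM i
  · change S ∈ Submodule.span ℂ _ at hS
    induction hS using Submodule.span_induction with
    | mem S hS =>
      -- Only the left vector must lie in `F`, because `e (u i)⋆ x y⋆ = (⟨u i, x⟩ e) y⋆`.
      obtain ⟨x, hx, y, -, rfl⟩ := hS
      have h1 : Tendsto (fun i => ‖⟪u i, x⟫_A‖ * (‖e‖ * ‖y‖)) l (𝓝 0) := by
        simpa using (hu x hx).norm.mul_const (‖e‖ * ‖y‖)
      refine squeeze_zero_norm (fun i => ?_) h1
      rw [ContinuousLinearMap.mul_apply', rankOne_mul_rankOne]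
      refine (norm_rankOne_le _ _).trans ?_
      rw [← mul_assoc]
      gcongr
      exact norm_smul_le _ _
    | zero => simpa using tendsto_const_nhds
    | add x y _ _ h1 h2 => simpa [mul_add] using h1.add h2
    | smul c x _ h1 => simpa using h1.const_smul c

end Compact

end General

end HilbertModule

/-! ### Existence of admissible data `q`, `ψ` -/

theorem exists_denseRange_pos : ∃ q : ℕ → unitInterval, (∀ n, 0 < q n) ∧ DenseRange q := by
  have hd : Dense (Set.Ioi (0 : unitInterval)) := by
    rw [dense_iff_closure_eq, closure_Ioi' ⟨1, zero_lt_one⟩]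
    exact Set.eq_univ_of_forall fun t => t.2.1
  have : Nonempty (Set.Ioi (0 : unitInterval)) := ⟨⟨1, Set.mem_Ioi.2 zero_lt_one⟩⟩
  refine ⟨fun n => (TopologicalSpace.denseSeq (Set.Ioi (0 : unitInterval)) n : unitInterval),
    fun n => (TopologicalSpace.denseSeq (Set.Ioi (0 : unitInterval)) n).2, ?_⟩
  exact hd.denseRange_val.comp (TopologicalSpace.denseRange_denseSeq _) continuous_subtype_val

/-- The indicator of `[0, q)` is a pointwise sum of squares of continuous functions. -/
theorem exists_hasSum_norm_sq_indicator_Iio (q : unitInterval) : ∃ ψ : ℕ → C(unitInterval, ℂ),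
    ∀ t : unitInterval,
      HasSum (fun m => ‖ψ m t‖ ^ 2) (Set.indicator (Set.Iio q) (fun _ => (1 : ℝ)) t) := by
  -- These functions increase from `f 0 = 0` to the indicator of `[0, q)`. The `ψ m` are the square
  -- roots of the increments, so the sum of squares telescopes.
  let f : ℕ → unitInterval → ℝ := fun m t => min 1 (m * max 0 ((q : ℝ) - t))
  have hmono : ∀ m t, 0 ≤ f (m + 1) t - f m t := fun m t => by
    refine sub_nonneg.2 (min_le_min le_rfl ?_)
    gcongr
    simp
  refine ⟨fun m => ⟨fun t => ((√(f (m + 1) t - f m t) : ℝ) : ℂ), by fun_prop⟩, fun t => ?_⟩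
  have h1 : (fun m => ‖((√(f (m + 1) t - f m t) : ℝ) : ℂ)‖ ^ 2) =
      fun m => f (m + 1) t - f m t := by
    funext m
    rw [Complex.norm_real, Real.norm_eq_abs, sq_abs, Real.sq_sqrt (hmono m t)]
  change HasSum (fun m => ‖((√(f (m + 1) t - f m t) : ℝ) : ℂ)‖ ^ 2) _
  rw [h1, hasSum_iff_tendsto_nat_of_nonneg fun m => hmono m t]
  simp only [Finset.sum_range_sub (fun m => f m t)]
  by_cases ht : t < q
  · have ht' : 0 < (q : ℝ) - t := sub_pos.2 ht
    rw [Set.indicator_of_mem (Set.mem_Iio.2 ht)]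
    obtain ⟨N, hN⟩ := exists_nat_gt (1 / ((q : ℝ) - t))
    refine tendsto_const_nhds.congr' ?_
    filter_upwards [eventually_ge_atTop N] with n hn
    have : 1 ≤ (n : ℝ) * ((q : ℝ) - t) := by
      rw [div_lt_iff₀ ht'] at hN
      refine hN.le.trans ?_
      gcongr
    simp [f, max_eq_right ht'.le, this]
  · have ht' : (q : ℝ) - t ≤ 0 := sub_nonpos.2 (not_lt.1 ht)
    rw [Set.indicator_of_notMem (by simpa using ht)]
    simp [f, max_eq_left ht']

/-! ### Computations in the standard module -/

namespace HilbertModule.Standard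

variable {A S : Type*} [CommCStarAlgebra A] [PartialOrder A] [StarOrderedRing A]

theorem star_inner (x y : Standard A S) : star ⟪x, y⟫_A = ⟪y, x⟫_A :=
  CStarModule.star_inner (A := A) x y

theorem inner_add_right (x y z : Standard A S) : ⟪x, y + z⟫_A = ⟪x, y⟫_A + ⟪x, z⟫_A :=
  CStarModule.inner_add_right (A := A) (E := Standard A S)

theorem inner_smul_right (a : A) (x y : Standard A S) : ⟪x, a • y⟫_A = a * ⟪x, y⟫_A :=
  CStarModule.inner_op_smul_right (A := A) (E := Standard A S)

variable [DecidableEq S]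

theorem coord_single (s t : S) (a : A) :
    (single s a : Standard A S).coord t = if t = s then a else 0 := by
  simp [single, coord, Pi.single_apply]

theorem inner_single_left (s : S) (a : A) (x : Standard A S) :
    ⟪single s a, x⟫_A = star a * x.coord s := by
  rw [inner_def, tsum_eq_single s fun t ht => by simp [coord_single, ht]]
  simp [coord_single]

theorem inner_single_right (s : S) (a : A) (x : Standard A S) :
    ⟪x, single s a⟫_A = star (x.coord s) * a := by
  rw [← Standard.star_inner, inner_single_left, star_mul, star_star]

theorem norm_single (s : S) (a : A) : ‖(single s a : Standard A S)‖ = ‖a‖ := by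
  rw [CStarModule.norm_eq_sqrt_norm_inner_self (A := A), inner_single_left, coord_single,
    if_pos rfl, CStarRing.norm_star_mul_self, Real.sqrt_mul_self (norm_nonneg _)]

end HilbertModule.Standard

open HilbertModule Standard

theorem inner_zeta_left (ψ : ℕ → ℕ → CI) (k l : ℕ) (x : ModuleE) :
    ⟪zeta ψ k l, x⟫_CI =
      (2 ^ (k + 1) : ℂ)⁻¹ • ψ k l * x.coord none - x.coord (some (k, l)) := by
  rw [zeta, CStarModule.inner_sub_left (A := CI), inner_single_left, inner_single_left]
  simp

theorem zeta_mem_moduleF (ψ : ℕ → ℕ → CI) (k l : ℕ) : zeta ψ k l ∈ ModuleF ψ :=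
  subset_closure (Submodule.subset_span ⟨k, l, rfl⟩)

/-- Evaluation at `t` is continuous, so norm convergence in `C[0,1]` becomes an ordinary series of
squares. -/
theorem hasSum_norm_coord_sq (x : ModuleE) (t : unitInterval) :
    HasSum (fun s => ‖x.coord s t‖ ^ 2) ((⟪x, x⟫_CI : CI) t).re := by
  have h1 : HasSum (fun s => star (x.coord s) * x.coord s) (⟪x, x⟫_CI : CI) := x.summable.hasSum
  have h2 := Complex.hasSum_re ((ContinuousMap.evalCLM ℂ t).hasSum h1)
  have h3 : (fun s => ‖x.coord s t‖ ^ 2) =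
      fun s => (ContinuousMap.evalCLM ℂ t (star (x.coord s) * x.coord s)).re := by
    funext s
    simp [← Complex.normSq_eq_norm_sq, Complex.normSq_apply]
  rw [h3]
  exact h2

/-! ### The orthogonal complement of `F` is zero -/

section Orthogonal

variable {q : ℕ → unitInterval} {ψ : ℕ → ℕ → CI}

/-- The weighted sum of the indicators of `[0, q k)` jumps by at least the `n`-th weight at `q n`. -/
theorem tsum_indicator_add_le (q : ℕ → unitInterval) {n : ℕ} {t : unitInterval} (ht : t < q n) :
    (∑' k, ((2 : ℝ) ^ (k + 1))⁻¹ ^ 2 *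
        Set.indicator (Set.Iio (q k)) (fun _ => (1 : ℝ)) (q n)) + ((2 : ℝ) ^ (n + 1))⁻¹ ^ 2 ≤
      ∑' k, ((2 : ℝ) ^ (k + 1))⁻¹ ^ 2 * Set.indicator (Set.Iio (q k)) (fun _ => (1 : ℝ)) t := by
  have hsum : ∀ t, Summable fun k => ((2 : ℝ) ^ (k + 1))⁻¹ ^ 2 *
      Set.indicator (Set.Iio (q k)) (fun _ => (1 : ℝ)) t := by
    intro t
    refine Summable.of_nonneg_of_le (fun k => ?_) (fun k => ?_)
      (summable_geometric_of_lt_one (r := (1 / 4 : ℝ)) (by norm_num) (by norm_num))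
    · exact mul_nonneg (by positivity) (Set.indicator_nonneg (fun _ _ => zero_le_one) _)
    · have h1 : Set.indicator (Set.Iio (q k)) (fun _ => (1 : ℝ)) t ≤ 1 :=
        Set.indicator_le_self' (fun _ _ => zero_le_one) t
      have h2 : ((2 : ℝ) ^ (k + 1))⁻¹ ^ 2 = (1 / 4) ^ k * (1 / 4) := by
        rw [← inv_pow, ← pow_mul, mul_comm, pow_mul, pow_succ]
        norm_num
      rw [h2]
      have h3 : (0 : ℝ) < (1 / 4) ^ k := by positivity
      nlinarith
  rw [add_comm, ← le_sub_iff_add_le, ← (hsum t).tsum_sub (hsum (q n))]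
  -- Indicators of `[0, q k)` decrease, so all terms of the difference are nonnegative. The `n`-th
  -- one is the full weight, as the half-open interval contains `t` but not `q n`.
  have hle := ((hsum t).sub (hsum (q n))).le_tsum n fun k _ => ?_
  · refine le_trans (le_of_eq ?_) hle
    simp [Set.indicator_of_mem (Set.mem_Iio.2 ht)]
  · rw [← mul_sub]
    refine mul_nonneg (by positivity) (sub_nonneg.2 ?_)
    by_cases hk : q n < q k
    · rw [Set.indicator_of_mem (Set.mem_Iio.2 hk), Set.indicator_of_mem (Set.mem_Iio.2 (ht.trans hk))]
    · rw [Set.indicator_of_notMem (by simpa using hk)]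
      exact Set.indicator_nonneg (fun _ _ => zero_le_one) _

/-- The entry `-1` of `ζ_{k,l}` lets orthogonality be solved for this coordinate, so `x` is
determined by its entry at `none`. -/
theorem coord_some_of_inner_zeta_eq_zero {x : ModuleE} (hx : ∀ k l, ⟪zeta ψ k l, x⟫_CI = 0)
    (k l : ℕ) : x.coord (some (k, l)) = (2 ^ (k + 1) : ℂ)⁻¹ • ψ k l * x.coord none := by
  have h := hx k l
  rw [inner_zeta_left, sub_eq_zero] at h
  exact h.symm

theorem re_inner_self_eq_of_inner_zeta_eq_zero
    (hψ : ∀ n (t : unitInterval),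
      HasSum (fun m => ‖ψ n m t‖ ^ 2) (Set.indicator (Set.Iio (q n)) (fun _ => (1 : ℝ)) t))
    {x : ModuleE} (hx : ∀ k l, ⟪zeta ψ k l, x⟫_CI = 0) (t : unitInterval) :
    ((⟪x, x⟫_CI : CI) t).re - ‖x.coord none t‖ ^ 2 =
      (∑' k, ((2 : ℝ) ^ (k + 1))⁻¹ ^ 2 * Set.indicator (Set.Iio (q k)) (fun _ => (1 : ℝ)) t) *
        ‖x.coord none t‖ ^ 2 := by
  have h1 := hasSum_norm_coord_sq x t
  have h2 : HasSum (fun p : ℕ × ℕ => ‖x.coord (some p) t‖ ^ 2)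
      (((⟪x, x⟫_CI : CI) t).re - ‖x.coord none t‖ ^ 2) := by
    -- With the entry at `none` set to `0`, the series is supported on the range of `some` and can
    -- be reindexed by pairs, then summed over `l` first.
    have h3 := h1.update none 0
    rw [zero_sub, neg_add_eq_sub] at h3
    exact ((Option.some_injective _).hasSum_iff fun s hs => by
      cases s <;> simp at hs ⊢).2 h3
  rw [← tsum_mul_right]
  refine ((h2.prod_fiberwise fun k => ?_).tsum_eq).symm
  have h3 : (fun l => ‖x.coord (some (k, l)) t‖ ^ 2) = fun l =>
      ((2 : ℝ) ^ (k + 1))⁻¹ ^ 2 * ‖ψ k l t‖ ^ 2 * ‖x.coord none t‖ ^ 2 := by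
    funext l
    rw [coord_some_of_inner_zeta_eq_zero hx]
    simp [mul_pow]
  rw [h3]
  exact ((hψ k t).mul_left _).mul_right _

/-- A continuous function equals `|x_0|²` times a function that jumps at each `q n`; this forces
`x_0` to vanish at the jumps, which are dense. -/
theorem eq_zero_of_inner_zeta_eq_zero (hq : ∀ n, 0 < q n) (hd : DenseRange q)
    (hψ : ∀ n (t : unitInterval),
      HasSum (fun m => ‖ψ n m t‖ ^ 2) (Set.indicator (Set.Iio (q n)) (fun _ => (1 : ℝ)) t))
    {x : ModuleE} (hx : ∀ k l, ⟪zeta ψ k l, x⟫_CI = 0) : x = 0 := by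
  have h0 : ∀ n, x.coord none (q n) = 0 := by
    intro n
    -- Positivity of `q n` provides points to its left, where the jump is seen.
    have : (𝓝[<] (q n)).NeBot := nhdsLT_neBot_of_exists_lt ⟨0, hq n⟩
    set h : unitInterval → ℝ := fun t => ∑' k, ((2 : ℝ) ^ (k + 1))⁻¹ ^ 2 *
      Set.indicator (Set.Iio (q k)) (fun _ => (1 : ℝ)) t
    have hc1 : Continuous fun t => ((⟪x, x⟫_CI : CI) t).re - ‖x.coord none t‖ ^ 2 := by fun_prop
    have hc2 : Continuous fun t =>
        (h (q n) + ((2 : ℝ) ^ (n + 1))⁻¹ ^ 2) * ‖x.coord none t‖ ^ 2 := by fun_prop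
    -- The discontinuous `h` enters only through the constant `h (q n)`. Letting `t` increase to `q
    -- n` gives `(h (q n) + 4^{-(n+1)}) |x_0(q n)|² ≤ h (q n) |x_0(q n)|²`.
    have hle := le_of_tendsto_of_tendsto
      ((hc2.tendsto (q n)).mono_left (nhdsWithin_le_nhds (s := Set.Iio (q n))))
      ((hc1.tendsto (q n)).mono_left nhdsWithin_le_nhds) (by
        filter_upwards [self_mem_nhdsWithin] with t ht
        rw [re_inner_self_eq_of_inner_zeta_eq_zero hψ hx]
        gcongr
        exact tsum_indicator_add_le q ht)
    rw [re_inner_self_eq_of_inner_zeta_eq_zero hψ hx, add_mul, add_le_iff_nonpos_right] at hle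
    have hpos : 0 < ((2 : ℝ) ^ (n + 1))⁻¹ ^ 2 := by positivity
    have h3 : ‖x.coord none (q n)‖ ^ 2 ≤ 0 := nonpos_of_mul_nonpos_right hle hpos
    simpa using le_antisymm h3 (by positivity)
  have h1 : x.coord none = 0 :=
    DFunLike.coe_injective (hd.equalizer (x.coord none).continuous continuous_zero (funext h0))
  refine Standard.ext fun s => ?_
  match s with
  | none => simpa using h1
  | some (k, l) => rw [coord_some_of_inner_zeta_eq_zero hx, h1, mul_zero]; rfl

theorem separatesPointsOf_sub_moduleF (hq : ∀ n, 0 < q n) (hd : DenseRange q)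
    (hψ : ∀ n (t : unitInterval),
      HasSum (fun m => ‖ψ n m t‖ ^ 2) (Set.indicator (Set.Iio (q n)) (fun _ => (1 : ℝ)) t)) :
    SeparatesPointsOf (Compact.sub (ModuleF ψ)) := by
  intro T hT
  set U := Compact.toAdjointable T with hU
  have hz : ∀ k l, U (zeta ψ k l) = 0 := by
    intro k l
    have h1 := congrArg Compact.toAdjointable (hT (Compact.rankOne (zeta ψ k l) (zeta ψ k l))
      (rankOne_mem_compactOn (zeta_mem_moduleF ψ k l) (zeta_mem_moduleF ψ k l)))
    rw [map_mul, map_zero, Compact.toAdjointable_rankOne, ← hU, mul_rankOne] at h1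
    -- The test vector is chosen so that its inner product with `ζ_{k,l}` is `1`, which recovers `U
    -- ζ_{k,l}`.
    have h2 : (Adjointable.rankOne (U (zeta ψ k l)) (zeta ψ k l) : Adjointable CI ModuleE)
        (single (some (k, l)) (-1)) = 0 := by rw [h1]; simp
    rw [Adjointable.rankOne_apply, inner_zeta_left] at h2
    simpa [coord_single] using h2
  -- Since `⟨ζ, U⋆ z⟩ = ⟨U ζ, z⟩ = 0`, every value of `U⋆` is orthogonal to all generators.
  have hs : star U = 0 := Adjointable.ext fun z => by
    rw [map_zero, _root_.zero_apply]
    refine eq_zero_of_inner_zeta_eq_zero hq hd hψ fun k l => ?_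
    rw [← Adjointable.inner_left, hz, CStarModule.inner_zero_left (A := CI)]
  exact Compact.toAdjointable_injective (by rw [← hU, star_eq_zero.1 hs, map_zero])

end Orthogonal

/-! ### Approximate normals to `F` and failure of nondegeneracy -/

section Degenerate

variable {q : ℕ → unitInterval} {ψ : ℕ → ℕ → CI}

/-- Finite truncations of the family `(1, (2⁻ᵏ ψ_{k,ℓ}))`, which is formally orthogonal to every
`ζ_{k,ℓ}`. -/
noncomputable def truncatedNormal (ψ : ℕ → ℕ → CI) (N : Finset (ℕ × ℕ)) : ModuleE :=
  single none 1 + ∑ p ∈ N, single (some p) ((2 ^ (p.1 + 1) : ℂ)⁻¹ • ψ p.1 p.2)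

theorem coord_sum {ι : Type*} (N : Finset ι) (f : ι → ModuleE) (s : Option (ℕ × ℕ)) :
    (∑ i ∈ N, f i).coord s = ∑ i ∈ N, (f i).coord s := by
  classical
  induction N using Finset.induction_on with
  | empty => simp
  | insert i N hi ih => rw [Finset.sum_insert hi, Finset.sum_insert hi, coord_add, ih]

theorem coord_none_truncatedNormal (ψ : ℕ → ℕ → CI) (N : Finset (ℕ × ℕ)) :
    (truncatedNormal ψ N).coord none = 1 := by
  simp [truncatedNormal, coord_sum, coord_single]

theorem coord_some_truncatedNormal (ψ : ℕ → ℕ → CI) (N : Finset (ℕ × ℕ)) (p : ℕ × ℕ) :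
    (truncatedNormal ψ N).coord (some p) =
      if p ∈ N then (2 ^ (p.1 + 1) : ℂ)⁻¹ • ψ p.1 p.2 else 0 := by
  simp [truncatedNormal, coord_sum, coord_single]

theorem inner_truncatedNormal_zeta {N : Finset (ℕ × ℕ)} {k l : ℕ} (h : (k, l) ∈ N) :
    ⟪truncatedNormal ψ N, zeta ψ k l⟫_CI = 0 := by
  rw [← Standard.star_inner, inner_zeta_left, coord_none_truncatedNormal,
    coord_some_truncatedNormal, if_pos h, mul_one, sub_self, star_zero]

/-- The bound is uniform in `N` and `t`, which makes the truncations bounded even though the full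
family is not norm summable. -/
theorem sum_norm_sq_le_one
    (hψ : ∀ n (t : unitInterval),
      HasSum (fun m => ‖ψ n m t‖ ^ 2) (Set.indicator (Set.Iio (q n)) (fun _ => (1 : ℝ)) t))
    (N : Finset (ℕ × ℕ)) (t : unitInterval) :
    ∑ p ∈ N, ((2 : ℝ) ^ (p.1 + 1))⁻¹ ^ 2 * ‖ψ p.1 p.2 t‖ ^ 2 ≤ 1 := by
  have hfib : ∀ k, ∑ l ∈ N.image Prod.snd, ‖ψ k l t‖ ^ 2 ≤ 1 := fun k =>
    (sum_le_hasSum _ (fun l _ => by positivity) (hψ k t)).trans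
      (Set.indicator_le_self' (fun _ _ => zero_le_one) t)
  calc ∑ p ∈ N, ((2 : ℝ) ^ (p.1 + 1))⁻¹ ^ 2 * ‖ψ p.1 p.2 t‖ ^ 2
      -- Enlarging `N` to a rectangle allows summing over `l` first, where each fibre contributes at
      -- most `1`.
      ≤ ∑ p ∈ N.image Prod.fst ×ˢ N.image Prod.snd,
          ((2 : ℝ) ^ (p.1 + 1))⁻¹ ^ 2 * ‖ψ p.1 p.2 t‖ ^ 2 :=
        Finset.sum_le_sum_of_subset_of_nonneg Finset.subset_product fun p _ _ => by positivity
    _ = ∑ k ∈ N.image Prod.fst, ((2 : ℝ) ^ (k + 1))⁻¹ ^ 2 *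
          ∑ l ∈ N.image Prod.snd, ‖ψ k l t‖ ^ 2 := by
        rw [Finset.sum_product]
        exact Finset.sum_congr rfl fun k _ => by rw [Finset.mul_sum]
    -- The weights `4^{-(k+1)}` are bounded crudely by `2^{-(k+1)}`, whose total is exactly `1`.
    _ ≤ ∑ k ∈ N.image Prod.fst, (1 / 2 : ℝ) ^ (k + 1) := by
        refine Finset.sum_le_sum fun k _ => ?_
        refine (mul_le_of_le_one_right (by positivity) (hfib k)).trans ?_
        have h1 : (1 / 2 : ℝ) ^ (k + 1) ≤ 1 := pow_le_one₀ (by norm_num) (by norm_num)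
        rw [← inv_pow, ← one_div, sq]
        exact mul_le_of_le_one_right (by positivity) h1
    _ ≤ 1 := by
        have h1 : HasSum (fun k : ℕ => (1 / 2 : ℝ) ^ (k + 1)) 1 := by
          simpa [pow_succ] using hasSum_geometric_two.mul_right (1 / 2 : ℝ)
        exact sum_le_hasSum _ (fun k _ => by positivity) h1

theorem norm_truncatedNormal_le
    (hψ : ∀ n (t : unitInterval),
      HasSum (fun m => ‖ψ n m t‖ ^ 2) (Set.indicator (Set.Iio (q n)) (fun _ => (1 : ℝ)) t))
    (N : Finset (ℕ × ℕ)) : ‖truncatedNormal ψ N‖ ≤ √2 := by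
  rw [CStarModule.norm_eq_sqrt_norm_inner_self (A := CI)]
  refine Real.sqrt_le_sqrt ((ContinuousMap.norm_le _ zero_le_two).2 fun t => ?_)
  have hin : ⟪truncatedNormal ψ N, truncatedNormal ψ N⟫_CI =
      1 + ∑ p ∈ N, star ((2 ^ (p.1 + 1) : ℂ)⁻¹ • ψ p.1 p.2) *
        ((2 ^ (p.1 + 1) : ℂ)⁻¹ • ψ p.1 p.2) := by
    -- Only the right argument is expanded; the left one is kept intact so that its coordinates can
    -- be read off.
    conv_lhs => enter [3]; rw [truncatedNormal]
    rw [Standard.inner_add_right, CStarModule.inner_sum_right (A := CI), inner_single_right,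
      coord_none_truncatedNormal, star_one, mul_one]
    congr 1
    refine Finset.sum_congr rfl fun p hp => ?_
    rw [inner_single_right, coord_some_truncatedNormal, if_pos hp]
  rw [hin, ContinuousMap.add_apply, ContinuousMap.one_apply, ContinuousMap.sum_apply]
  refine (norm_add_le _ _).trans ?_
  rw [norm_one]
  have h1 := (norm_sum_le N fun p => (star ((2 ^ (p.1 + 1) : ℂ)⁻¹ • ψ p.1 p.2) *
        ((2 ^ (p.1 + 1) : ℂ)⁻¹ • ψ p.1 p.2) : CI) t).trans
    (le_trans (le_of_eq (Finset.sum_congr rfl fun p _ => ?_)) (sum_norm_sq_le_one hψ N t))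
  · linarith
  · simp
    ring

/-- On a generator the inner product is exactly `0` once `N` contains its index; the uniform norm
bound extends the limit from the span to its closure. -/
theorem tendsto_inner_truncatedNormal
    (hψ : ∀ n (t : unitInterval),
      HasSum (fun m => ‖ψ n m t‖ ^ 2) (Set.indicator (Set.Iio (q n)) (fun _ => (1 : ℝ)) t))
    {x : ModuleE} (hx : x ∈ ModuleF ψ) :
    Tendsto (fun N => ⟪truncatedNormal ψ N, x⟫_CI) atTop (𝓝 0) := by
  refine tendsto_zero_of_mem_closure (M := √2)
    (D := fun N => (CStarModule.innerSL (truncatedNormal ψ N) : ModuleE →L[ℂ] CI))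
    (fun N => ?_) (fun y hy => ?_) hx
  · refine ContinuousLinearMap.opNorm_le_bound _ (Real.sqrt_nonneg _) fun y => ?_
    refine (CStarModule.norm_inner_le (A := CI) ModuleE).trans ?_
    gcongr
    exact norm_truncatedNormal_le hψ N
  · change Tendsto (fun N => ⟪truncatedNormal ψ N, y⟫_CI) atTop (𝓝 0)
    change y ∈ Submodule.span CI _ at hy
    induction hy using Submodule.span_induction with
    | mem y hy =>
      obtain ⟨k, l, rfl⟩ := hy
      refine tendsto_const_nhds.congr' ?_
      filter_upwards [eventually_ge_atTop {(k, l)}] with N hN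
      exact (inner_truncatedNormal_zeta (hN (Finset.mem_singleton_self _))).symm
    | zero => simpa only [CStarModule.inner_zero_right (A := CI)] using tendsto_const_nhds
    | add y z _ _ h1 h2 => simpa only [Standard.inner_add_right, add_zero] using h1.add h2
    | smul c y _ h1 => simpa only [Standard.inner_smul_right, mul_zero] using h1.const_mul c

/-- The obstruction is applied to `e u_N⋆` and `θ = e e⋆`: as `u_N` has entry `1` at `none`, `⟨u_N,
e⟩ = 1` and `e u_N⋆ e e⋆ = e e⋆`. -/
theorem not_actsNondegenerately_sub_moduleF
    (hψ : ∀ n (t : unitInterval),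
      HasSum (fun m => ‖ψ n m t‖ ^ 2) (Set.indicator (Set.Iio (q n)) (fun _ => (1 : ℝ)) t))
    {H : Type*} [NormedAddCommGroup H] [InnerProductSpace ℂ H] [CompleteSpace H]
    (π : Compact CI ModuleE →⋆ₙₐ[ℂ] (H →L[ℂ] H)) (hπ : Function.Injective π) :
    ¬ ActsNondegenerately π (Compact.sub (ModuleF ψ)) := by
  set e : ModuleE := single none 1
  have he : ‖e‖ = 1 := by rw [norm_single, norm_one]
  refine not_actsNondegenerately_of_tendsto_zero (l := atTop) (M := √2)
    (D := fun N => Compact.rankOne e (truncatedNormal ψ N)) (θ := Compact.rankOne e e)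
    (fun N => ?_)
    (fun T hT => Compact.tendsto_rankOne_mul_zero (norm_truncatedNormal_le hψ)
      (fun x hx => tendsto_inner_truncatedNormal hψ hx) e hT) (fun h => ?_) (fun N => ?_) π hπ
  · refine (norm_rankOne_le e (truncatedNormal ψ N)).trans ?_
    rw [he, one_mul]
    exact norm_truncatedNormal_le hψ N
  · have h1 : (Adjointable.rankOne e e : Adjointable CI ModuleE) e = 0 := by
      rw [← Compact.toAdjointable_rankOne, h, map_zero]; simp
    rw [Adjointable.rankOne_apply, inner_single_left, coord_single] at h1
    simp only [if_true, star_one, mul_one, one_smul] at h1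
    rw [h1, norm_zero] at he
    exact zero_ne_one he
  · refine Compact.toAdjointable_injective ?_
    rw [map_mul, Compact.toAdjointable_rankOne, Compact.toAdjointable_rankOne,
      rankOne_mul_rankOne, inner_single_right, coord_none_truncatedNormal, star_one, mul_one,
      one_smul]

end Degenerate

theorem theorem2 :
    (∃ (A : Type) (_ : NonUnitalCStarAlgebra A) (B : NonUnitalStarSubalgebra ℂ A),
      IsHereditaryCStarSubalgebra B ∧ SeparatesPointsOf B ∧
        ∀ (H : Type u) [NormedAddCommGroup H] [InnerProductSpace ℂ H] [CompleteSpace H]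
          (π : A →⋆ₙₐ[ℂ] (H →L[ℂ] H)), Function.Injective π → ¬ ActsNondegenerately π B) ∧
    ∀ (q : ℕ → unitInterval) (ψ : ℕ → ℕ → C(unitInterval, ℂ)),
      (∀ n, 0 < q n) → DenseRange q →
      (∀ n (t : unitInterval),
        HasSum (fun m => ‖ψ n m t‖ ^ 2) (Set.indicator (Set.Iio (q n)) (fun _ => (1 : ℝ)) t)) →
      IsHereditaryCStarSubalgebra (HilbertModule.Compact.sub (ModuleF ψ)) ∧
      SeparatesPointsOf (HilbertModule.Compact.sub (ModuleF ψ)) ∧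
        ∀ (H : Type u) [NormedAddCommGroup H] [InnerProductSpace ℂ H] [CompleteSpace H]
          (π : HilbertModule.Compact C(unitInterval, ℂ) ModuleE →⋆ₙₐ[ℂ] (H →L[ℂ] H)),
          Function.Injective π → ¬ ActsNondegenerately π (HilbertModule.Compact.sub (ModuleF ψ)) := by
  have key : ∀ (q : ℕ → unitInterval) (ψ : ℕ → ℕ → C(unitInterval, ℂ)),
      (∀ n, 0 < q n) → DenseRange q →
      (∀ n (t : unitInterval),
        HasSum (fun m => ‖ψ n m t‖ ^ 2) (Set.indicator (Set.Iio (q n)) (fun _ => (1 : ℝ)) t)) →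
      IsHereditaryCStarSubalgebra (HilbertModule.Compact.sub (ModuleF ψ)) ∧
      SeparatesPointsOf (HilbertModule.Compact.sub (ModuleF ψ)) ∧
        ∀ (H : Type u) [NormedAddCommGroup H] [InnerProductSpace ℂ H] [CompleteSpace H]
          (π : HilbertModule.Compact C(unitInterval, ℂ) ModuleE →⋆ₙₐ[ℂ] (H →L[ℂ] H)),
          Function.Injective π → ¬ ActsNondegenerately π (HilbertModule.Compact.sub (ModuleF ψ)) :=
    fun q ψ hq hd hψ => ⟨Compact.isHereditaryCStarSubalgebra_sub _,
      separatesPointsOf_sub_moduleF hq hd hψ,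
      fun _ _ _ _ π hπ => not_actsNondegenerately_sub_moduleF hψ π hπ⟩
  refine ⟨?_, key⟩
  -- The bare existence statement is the explicit one for any admissible choice of `q` and `ψ`.
  obtain ⟨q, hq, hd⟩ := exists_denseRange_pos
  choose ψ hψ using fun n => exists_hasSum_norm_sq_indicator_Iio (q n)
  exact ⟨_, inferInstance, _, key q ψ hq hd hψ⟩
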